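/- Let $H$ be a complex Hilbert space of dimension $2$ and let $\mathcal{B}(H)$ be the algebra of bounded linear operators on $H$. For $a,b\in\mathcal{B}(H)$ let $T_{a,b}\colon\mathcal{B}(H)\to\mathcal{B}(H)$ be the operator $T_{a,b}(x)=axb+bxa$, with operator norm $\|T_{a,b}\|$ and completely bounded norm $$\|T_{a,b}\|_{cb}=\sup_{n\ge 1}\ \sup\bigl\{\,\bigl\|[T_{a,b}(x_{ij})]_{i,j=1}^n\bigr\| : [x_{ij}]_{i,j=1}^n\in M_n(\mathcal{B}(H)),\ \bigl\|[x_{ij}]_{i,j=1}^n\bigr\|\le 1\,\bigr\},$$ where $M_n(\mathcal{B}(H))$ carries the norm of $\mathcal{B}(H^n)$, $H^n$ being the Hilbert space direct sum of $n$ copies of $H$. If $a$ and $b$ commute ($a$, $b$ not necessarily normal), then $$\|T_{a,b}\|_{cb}=\|T_{a,b}\|.$$ -/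

import Mathlib

open scoped ENNReal

noncomputable section

/-- The operator on the Hilbert space `Hⁿ` (the `ℓ²` direct sum of `n` copies of `H`) given by an
`n × n` matrix of bounded operators on `H`: `(A ξ)ᵢ = ∑ⱼ Aᵢⱼ ξⱼ`. -/
def blockOperator {H : Type*} [NormedAddCommGroup H] [InnerProductSpace ℂ H] {n : ℕ}
    (A : Matrix (Fin n) (Fin n) (H →L[ℂ] H)) :
    PiLp 2 (fun _ : Fin n => H) →L[ℂ] PiLp 2 (fun _ : Fin n => H) :=
  ((PiLp.continuousLinearEquiv 2 ℂ (fun _ : Fin n => H)).symm :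
      (Fin n → H) →L[ℂ] PiLp 2 (fun _ : Fin n => H)) ∘L
    ContinuousLinearMap.pi
      (fun i => ∑ j, A i j ∘L PiLp.proj 2 (fun _ : Fin n => H) j)

theorem blockOperator_apply {H : Type*} [NormedAddCommGroup H] [InnerProductSpace ℂ H] {n : ℕ}
    (A : Matrix (Fin n) (Fin n) (H →L[ℂ] H)) (ξ : PiLp 2 (fun _ : Fin n => H)) (i : Fin n) :
    blockOperator A ξ i = ∑ j, A i j (ξ j) := by
  simp [blockOperator]

/-- The completely bounded norm `sup_n ‖T_n‖` of a bounded linear map `T` on `B(H)`, where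
`T_n [Aᵢⱼ] = [T Aᵢⱼ]` on `M_n(B(H))`, and `M_n(B(H))` is normed as the operators on `Hⁿ`.
It takes values in `[0, ∞]`, being `∞` when `T` is not completely bounded. -/
def cbNorm {H : Type*} [NormedAddCommGroup H] [InnerProductSpace ℂ H]
    (T : (H →L[ℂ] H) →L[ℂ] (H →L[ℂ] H)) : ℝ≥0∞ :=
  ⨆ (n : ℕ) (A : Matrix (Fin n) (Fin n) (H →L[ℂ] H)) (_ : ‖blockOperator A‖ ≤ 1),
    ‖blockOperator (A.map T)‖ₑ

/-- The Jordan elementary operator `T_{a,b} x = a x b + b x a` on `B(H)`. -/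
def jordanElementary {H : Type*} [NormedAddCommGroup H] [InnerProductSpace ℂ H]
    (a b : H →L[ℂ] H) : (H →L[ℂ] H) →L[ℂ] (H →L[ℂ] H) :=
  ContinuousLinearMap.mulLeftRight ℂ (H →L[ℂ] H) a b +
    ContinuousLinearMap.mulLeftRight ℂ (H →L[ℂ] H) b a

theorem jordanElementary_apply {H : Type*} [NormedAddCommGroup H] [InnerProductSpace ℂ H]
    (a b x : H →L[ℂ] H) : jordanElementary a b x = a * x * b + b * x * a := by
  simp [jordanElementary]

end

open scoped InnerProductSpace

theorem exists_norm_eq_one_mul_eq_conj_mul {α β : ℂ} (h : ‖α‖ = ‖β‖) :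
    ∃ z : ℂ, ‖z‖ = 1 ∧ z * α = (starRingEnd ℂ) z * β := by
  by_cases hα : α = 0
  · subst hα
    have hβ : β = 0 := by simpa using h.symm
    exact ⟨1, by simp, by simp [hβ]⟩
  · obtain ⟨z, hz⟩ := IsAlgClosed.exists_pow_nat_eq (β / α) (n := 2) (by norm_num)
    have hz1 : ‖z‖ = 1 := by
      have : ‖z‖ ^ 2 = 1 := by
        rw [← norm_pow, hz, norm_div, h, div_self]
        rwa [← h, norm_ne_zero_iff]
      nlinarith [norm_nonneg z]
    refine ⟨z, hz1, ?_⟩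
    have hβ : β = z ^ 2 * α := by rw [hz]; field_simp
    have hzz : (starRingEnd ℂ) z * z = 1 := by
      rw [Complex.conj_mul', hz1]; simp
    rw [hβ]
    linear_combination (-z * α) * hzz

/-! ### Conjugations and complex symmetric operators in dimension 2 -/

section

variable {H : Type*} [NormedAddCommGroup H] [InnerProductSpace ℂ H]

/-- A conjugation: a conjugate-linear involution `J` such that `⟪J x, y⟫` is symmetric. -/
structure IsConjugation (J : H →ₛₗ[starRingEnd ℂ] H) : Prop where
  involutive : ∀ x, J (J x) = x
  inner_symm : ∀ x y, ⟪J x, y⟫_ℂ = ⟪J y, x⟫_ℂ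

theorem IsConjugation.norm_map {J : H →ₛₗ[starRingEnd ℂ] H} (hJ : IsConjugation J) (x : H) :
    ‖J x‖ = ‖x‖ := by
  have h : ⟪J x, J x⟫_ℂ = ⟪x, x⟫_ℂ := by rw [hJ.inner_symm, hJ.involutive]
  rw [inner_self_eq_norm_sq_to_K, inner_self_eq_norm_sq_to_K] at h
  have h2 : ‖J x‖ ^ 2 = ‖x‖ ^ 2 := by exact_mod_cast h
  exact (sq_eq_sq₀ (norm_nonneg _) (norm_nonneg _)).1 h2

/-- Complex conjugation of the coordinates in an orthonormal basis. -/
noncomputable def OrthonormalBasis.conjugation {ι : Type*} [Fintype ι] (e : OrthonormalBasis ι ℂ H) :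
    H →ₛₗ[starRingEnd ℂ] H where
  toFun x := ∑ i, ⟪x, e i⟫_ℂ • e i
  map_add' x y := by simp [add_smul, Finset.sum_add_distrib]
  map_smul' c x := by simp [smul_smul, Finset.smul_sum, mul_comm]

theorem OrthonormalBasis.conjugation_apply {ι : Type*} [Fintype ι]
    (e : OrthonormalBasis ι ℂ H) (x : H) : e.conjugation x = ∑ i, ⟪x, e i⟫_ℂ • e i := rfl

theorem OrthonormalBasis.isConjugation_conjugation {ι : Type*} [Fintype ι]
    (e : OrthonormalBasis ι ℂ H) : IsConjugation e.conjugation := by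
  classical
  have key : ∀ x y, ⟪e.conjugation x, y⟫_ℂ = ∑ i, ⟪e i, x⟫_ℂ * ⟪e i, y⟫_ℂ := by
    intro x y
    simp [e.conjugation_apply, mul_comm]
  refine ⟨fun x => ?_, fun x y => ?_⟩
  · rw [e.conjugation_apply]
    have : ∀ i, ⟪e.conjugation x, e i⟫_ℂ = ⟪e i, x⟫_ℂ := by
      intro i
      simp [key, orthonormal_iff_ite.1 e.orthonormal]
    simp [this, e.sum_repr']
  · simp [key, mul_comm]

/-- The direction of `u + v` works because `‖u‖ = ‖v‖`; if `v = -u`, that of `I • u` does. This `f`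
becomes the first vector of a basis whose conjugation maps `u` to `v`. -/
theorem exists_norm_eq_one_inner_eq_inner [Nontrivial H] {u v : H} (h : ‖u‖ = ‖v‖) :
    ∃ f : H, ‖f‖ = 1 ∧ ⟪u, f⟫_ℂ = ⟪f, v⟫_ℂ := by
  have normalize : ∀ w : H, w ≠ 0 → ⟪u, w⟫_ℂ = ⟪w, v⟫_ℂ →
      ∃ f : H, ‖f‖ = 1 ∧ ⟪u, f⟫_ℂ = ⟪f, v⟫_ℂ := fun w hw hi =>
    ⟨((‖w‖⁻¹ : ℝ) : ℂ) • w, by simp [norm_smul, hw], by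
      rw [inner_smul_left, inner_smul_right, hi, Complex.conj_ofReal]⟩
  by_cases h1 : u + v = 0
  · obtain rfl : v = -u := (neg_eq_of_add_eq_zero_right h1).symm
    by_cases hu : u = 0
    · obtain ⟨w, hw⟩ := exists_ne (0 : H)
      exact normalize w hw (by simp [hu])
    · exact normalize (Complex.I • u) (by simp [hu]) (by simp [inner_smul_left])
  · refine normalize _ h1 ?_
    rw [inner_add_left, inner_add_right, inner_self_eq_norm_sq_to_K, inner_self_eq_norm_sq_to_K, h]
    ring

theorem exists_orthonormalBasis_of_norm_eq_one (hH : Module.finrank ℂ H = 2) {f : H}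
    (hf : ‖f‖ = 1) : ∃ e : OrthonormalBasis (Fin 2) ℂ H, e 0 = f := by
  have : FiniteDimensional ℂ H := Module.finite_of_finrank_pos (by omega)
  have hon : Orthonormal ℂ (Set.domRestrict ({0} : Set (Fin 2)) (fun _ : Fin 2 => f)) := by
    refine ⟨fun _ => hf, fun i j hij => (hij (Subsingleton.elim i j)).elim⟩
  obtain ⟨e, he⟩ := hon.exists_orthonormalBasis_extension_of_card_eq (by simp [hH])
  exact ⟨e, he 0 rfl⟩

/-- Conjugation in a basis `e` maps `u` to `v` exactly when `⟪u, e i⟫ = ⟪e i, v⟫` for all `i`. Once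
this holds for `e 0`, Parseval equates the moduli for `e 1`, and a phase on `e 1` does the rest. -/
theorem exists_isConjugation_apply_eq (hH : Module.finrank ℂ H = 2) {u v : H} (h : ‖u‖ = ‖v‖) :
    ∃ J : H →ₛₗ[starRingEnd ℂ] H, IsConjugation J ∧ J u = v := by
  have : Nontrivial H := Module.nontrivial_of_finrank_pos (R := ℂ) (by omega)
  obtain ⟨f, hf, hfi⟩ := exists_norm_eq_one_inner_eq_inner h
  obtain ⟨e, rfl⟩ := exists_orthonormalBasis_of_norm_eq_one hH hf
  have h1 : ‖⟪u, e 1⟫_ℂ‖ = ‖⟪e 1, v⟫_ℂ‖ := by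
    have hu := e.sum_sq_norm_inner_right u
    have hv := e.sum_sq_norm_inner_right v
    rw [Fin.sum_univ_two] at hu hv
    rw [← h, ← hu, ← hfi, norm_inner_symm u (e 0)] at hv
    rw [norm_inner_symm u]
    exact ((sq_eq_sq₀ (norm_nonneg _) (norm_nonneg _)).1 (by linarith))
  obtain ⟨z, hz, hzi⟩ := exists_norm_eq_one_mul_eq_conj_mul h1
  have hon : Orthonormal ℂ ![e 0, z • e 1] := by
    have h01 : ⟪e 0, e 1⟫_ℂ = 0 := e.orthonormal.2 (by decide)
    have h10 : ⟪e 1, e 0⟫_ℂ = 0 := e.orthonormal.2 (by decide)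
    constructor
    · intro i
      fin_cases i <;> simp [norm_smul, hz]
    · intro i j hij
      fin_cases i <;> fin_cases j <;> simp_all [inner_smul_left, inner_smul_right]
  obtain ⟨e', he'⟩ : ∃ e' : OrthonormalBasis (Fin 2) ℂ H, ⇑e' = ![e 0, z • e 1] := by
    have hspan : ⊤ ≤ Submodule.span ℂ (Set.range ![e 0, z • e 1]) := by
      rw [LinearIndependent.span_eq_top_of_card_eq_finrank hon.linearIndependent (by simp [hH])]
    exact ⟨OrthonormalBasis.mk hon hspan, by simp⟩
  refine ⟨e'.conjugation, e'.isConjugation_conjugation, ?_⟩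
  have : ∀ i, ⟪u, e' i⟫_ℂ = ⟪e' i, v⟫_ℂ := by
    intro i
    fin_cases i
    · simpa [he'] using hfi
    · simpa [he', inner_smul_left, inner_smul_right, mul_comm] using hzi
  rw [e'.conjugation_apply]
  simp [this, e'.sum_repr']

/-- A nonzero kernel forces rank at most one. The factor `√‖c (e 1)‖` balances the two vectors, so
that some conjugation maps `u` to `v`. -/
theorem exists_eq_inner_smul_of_apply_eq_zero (hH : Module.finrank ℂ H = 2) {c : H →ₗ[ℂ] H}
    {w : H} (hw : w ≠ 0) (hcw : c w = 0) :
    ∃ u v : H, ‖u‖ = ‖v‖ ∧ ∀ x, c x = ⟪v, x⟫_ℂ • u := by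
  obtain ⟨e, he⟩ := exists_orthonormalBasis_of_norm_eq_one hH
    (f := ((‖w‖⁻¹ : ℝ) : ℂ) • w) (by simp [norm_smul, hw])
  have he0 : c (e 0) = 0 := by rw [he, map_smul, hcw, smul_zero]
  have hc : ∀ x, c x = ⟪e 1, x⟫_ℂ • c (e 1) := by
    intro x
    conv_lhs => rw [← e.sum_repr' x, Fin.sum_univ_two]
    simp [he0]
  by_cases h1 : c (e 1) = 0
  · exact ⟨0, 0, rfl, fun x => by rw [hc, h1]; simp⟩
  · have hr : 0 < ‖c (e 1)‖ := norm_pos_iff.2 h1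
    set r := Real.sqrt ‖c (e 1)‖ with hrdef
    have hr0 : 0 < r := Real.sqrt_pos.2 hr
    have hrr : r * r = ‖c (e 1)‖ := Real.mul_self_sqrt hr.le
    refine ⟨((r⁻¹ : ℝ) : ℂ) • c (e 1), (r : ℂ) • e 1, ?_, fun x => ?_⟩
    · rw [norm_smul, norm_smul, ← hrr, e.norm_eq_one]
      simp [abs_of_pos hr0]
      field_simp
    · rw [hc x, inner_smul_left, smul_smul, Complex.conj_ofReal]
      congr 1
      push_cast
      have : (r : ℂ) ≠ 0 := by exact_mod_cast hr0.ne'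
      field_simp

/-- Scalars are symmetric for every conjugation, so only the rank-one part `a - μ`, with `μ` an
eigenvalue, matters; it is symmetric once `J u = v`. -/
theorem exists_isConjugation_symmetric (hH : Module.finrank ℂ H = 2) (a : H →L[ℂ] H) :
    ∃ J : H →ₛₗ[starRingEnd ℂ] H, IsConjugation J ∧ ∀ x y, ⟪J (a x), y⟫_ℂ = ⟪J x, a y⟫_ℂ := by
  have : FiniteDimensional ℂ H := Module.finite_of_finrank_pos (by omega)
  have : Nontrivial H := Module.nontrivial_of_finrank_pos (R := ℂ) (by omega)
  obtain ⟨μ, hμ⟩ := Module.End.exists_eigenvalue (a : H →ₗ[ℂ] H)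
  obtain ⟨w, hw⟩ := hμ.exists_hasEigenvector
  obtain ⟨u, v, huv, hc⟩ := exists_eq_inner_smul_of_apply_eq_zero hH
    (c := (a : H →ₗ[ℂ] H) - μ • LinearMap.id) hw.2 (by
      have := hw.apply_eq_smul
      simp_all)
  obtain ⟨J, hJ, hJu⟩ := exists_isConjugation_apply_eq hH huv
  refine ⟨J, hJ, ?_⟩
  have ha : ∀ x, a x = ⟪v, x⟫_ℂ • u + μ • x := by
    intro x
    rw [← hc x]
    simp
  intro x y
  have hxu : ⟪J x, u⟫_ℂ = ⟪v, x⟫_ℂ := by rw [hJ.inner_symm, hJu]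
  rw [ha, ha]
  simp only [map_add, map_smulₛₗ, hJu, inner_add_left, inner_add_right, inner_smul_left,
    inner_smul_right, hxu, Complex.conj_conj]
  ring

/-- Since `w` is cyclic for `a`, an operator commuting with `a` is determined by its value at `w`.
-/
theorem eq_smul_add_smul_of_commute (hH : Module.finrank ℂ H = 2) {a b : H →L[ℂ] H}
    (hab : a * b = b * a) {w : H} (hw : LinearIndependent ℂ ![w, a w]) :
    ∃ s r : ℂ, ∀ x, b x = s • x + r • a x := by
  have : FiniteDimensional ℂ H := Module.finite_of_finrank_pos (by omega)
  have htop := hw.span_eq_top_of_card_eq_finrank (by simp [hH])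
  have hrep : ∀ x : H, ∃ s r : ℂ, s • w + r • a w = x := by
    intro x
    have hx : x ∈ Submodule.span ℂ (Set.range ![w, a w]) := htop ▸ Submodule.mem_top
    rw [Matrix.range_cons, Matrix.range_cons, Matrix.range_empty, Set.union_empty,
      Set.singleton_union] at hx
    exact Submodule.mem_span_pair.1 hx
  have hcomm : ∀ x, b (a x) = a (b x) := fun x => (congrArg (fun f => f x) hab).symm
  obtain ⟨s, r, hsr⟩ := hrep (b w)
  refine ⟨s, r, fun x => ?_⟩
  obtain ⟨t, q, rfl⟩ := hrep x
  simp only [map_add, map_smul, hcomm, ← hsr, smul_add]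
  simp only [smul_smul, mul_comm]
  abel

theorem exists_isConjugation_symmetric_of_commute (hH : Module.finrank ℂ H = 2)
    {a b : H →L[ℂ] H} (hab : a * b = b * a) :
    ∃ J : H →ₛₗ[starRingEnd ℂ] H, IsConjugation J ∧
      (∀ x y, ⟪J (a x), y⟫_ℂ = ⟪J x, a y⟫_ℂ) ∧ ∀ x y, ⟪J (b x), y⟫_ℂ = ⟪J x, b y⟫_ℂ := by
  have extend : ∀ {J : H →ₛₗ[starRingEnd ℂ] H} {c d : H →L[ℂ] H} {s r : ℂ},
      (∀ x y, ⟪J (c x), y⟫_ℂ = ⟪J x, c y⟫_ℂ) → (∀ x, d x = s • x + r • c x) →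
      ∀ x y, ⟪J (d x), y⟫_ℂ = ⟪J x, d y⟫_ℂ := by
    intro J c d s r hc hd x y
    simp only [hd, map_add, map_smulₛₗ, inner_add_left, inner_add_right, inner_smul_left,
      inner_smul_right, hc, Complex.conj_conj]
  by_cases h : ∃ w, LinearIndependent ℂ ![w, a w]
  · obtain ⟨w, hw⟩ := h
    obtain ⟨s, r, hb⟩ := eq_smul_add_smul_of_commute hH hab hw
    obtain ⟨J, hJ, ha⟩ := exists_isConjugation_symmetric hH a
    exact ⟨J, hJ, ha, extend ha hb⟩
  -- With no cyclic vector `a` is a scalar, so a conjugation chosen for `b` serves both.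
  · push Not at h
    obtain ⟨s, hs⟩ := (a : H →ₗ[ℂ] H).exists_eq_smul_id_of_forall_notLinearIndependent h
    obtain ⟨J, hJ, hb⟩ := exists_isConjugation_symmetric hH b
    refine ⟨J, hJ, extend (s := s) (r := 0) hb fun x => ?_, hb⟩
    simpa using congrArg (fun f => f x) hs

end

/-! ### Lower bound, and the tangent inequality at a maximizer -/

section

variable {H : Type*} [NormedAddCommGroup H] [InnerProductSpace ℂ H]

theorem two_mul_norm_mul_norm_le_norm_jordanElementary (hH : Module.finrank ℂ H = 2)
    {a b : H →L[ℂ] H} {J : H →ₛₗ[starRingEnd ℂ] H} (hJ : IsConjugation J)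
    (ha : ∀ x y, ⟪J (a x), y⟫_ℂ = ⟪J x, a y⟫_ℂ) (hb : ∀ x y, ⟪J (b x), y⟫_ℂ = ⟪J x, b y⟫_ℂ)
    {η : H} (hη : ‖η‖ = 1) : 2 * (‖a η‖ * ‖b η‖) ≤ ‖jordanElementary a b‖ := by
  have : FiniteDimensional ℂ H := Module.finite_of_finrank_pos (by omega)
  by_cases ha0 : a η = 0
  · rw [ha0, norm_zero]
    exact le_of_eq_of_le (by ring) (norm_nonneg (jordanElementary a b))
  by_cases hb0 : b η = 0
  · rw [hb0, norm_zero]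
    exact le_of_eq_of_le (by ring) (norm_nonneg (jordanElementary a b))
  have hna : (‖a η‖ : ℂ) ≠ 0 := by simpa using ha0
  have hnb : (‖b η‖ : ℂ) ≠ 0 := by simpa using hb0
  set p : H := (‖a η‖ : ℂ)⁻¹ • a η with hp
  set q : H := (‖b η‖ : ℂ)⁻¹ • b η with hq
  have hp1 : ‖p‖ = 1 := by simp [hp, norm_smul, ha0]
  have hq1 : ‖q‖ = 1 := by simp [hq, norm_smul, hb0]
  have hap : a η = (‖a η‖ : ℂ) • p := by rw [hp, smul_inv_smul₀ hna]
  have hbq : b η = (‖b η‖ : ℂ) • q := by rw [hq, smul_inv_smul₀ hnb]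
  obtain ⟨K, hK, hKp⟩ := exists_isConjugation_apply_eq hH (hp1.trans hq1.symm)
  have hKq : K q = p := by rw [← hKp, hK.involutive]
  -- A product of two conjugations is linear and isometric; this one sends `q` to `J p` and `p` to
  -- `J q`.
  let x : H →L[ℂ] H := LinearMap.mkContinuous
    { toFun := fun y => J (K y)
      map_add' := by simp
      map_smul' := by simp } 1 fun y => by simp [hJ.norm_map, hK.norm_map]
  have hx : ∀ y, x y = J (K y) := fun _ => rfl
  have hxn : ‖x‖ ≤ 1 := LinearMap.mkContinuous_norm_le _ zero_le_one _
  have hJJ : ∀ y, ‖y‖ = 1 → ⟪J y, J y⟫_ℂ = 1 := by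
    intro y hy
    rw [inner_self_eq_norm_sq_to_K, hJ.norm_map, hy]
    simp
  have hinner : ⟪J η, jordanElementary a b x η⟫_ℂ = ((2 * (‖a η‖ * ‖b η‖) : ℝ) : ℂ) := by
    have h1 : ⟪J η, a (x (b η))⟫_ℂ = ‖a η‖ * ‖b η‖ := by
      rw [← ha, hbq, map_smul, hx, hKq, inner_smul_right, hap, map_smulₛₗ, inner_smul_left]
      simp only [← hap, ← hbq]
      rw [hJJ p hp1, Complex.conj_ofReal, Complex.conj_ofReal]
      ring
    have h2 : ⟪J η, b (x (a η))⟫_ℂ = ‖a η‖ * ‖b η‖ := by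
      rw [← hb, hap, map_smul, hx, hKp, inner_smul_right, hbq, map_smulₛₗ, inner_smul_left]
      simp only [← hap, ← hbq]
      rw [hJJ q hq1, Complex.conj_ofReal, Complex.conj_ofReal]
      ring
    rw [jordanElementary_apply]
    simp only [add_apply, mul_apply_eq_comp, inner_add_right, h1, h2]
    push_cast
    ring
  calc 2 * (‖a η‖ * ‖b η‖) = ‖⟪J η, jordanElementary a b x η⟫_ℂ‖ := by
        rw [hinner, Complex.norm_real, Real.norm_of_nonneg (by positivity)]
    _ ≤ ‖J η‖ * ‖jordanElementary a b x η‖ := norm_inner_le_norm _ _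
    _ ≤ ‖jordanElementary a b x‖ := by
        rw [hJ.norm_map, hη, one_mul]
        exact (ContinuousLinearMap.le_opNorm _ _).trans_eq (by rw [hη, mul_one])
    _ ≤ ‖jordanElementary a b‖ := by
        refine (ContinuousLinearMap.le_opNorm _ _).trans ?_
        exact mul_le_of_le_one_right (norm_nonneg _) hxn

theorem coeff_of_quartic_nonpos {c₁ c₂ c₃ c₄ : ℝ}
    (h : ∀ s : ℝ, c₁ * s + c₂ * s ^ 2 + c₃ * s ^ 3 + c₄ * s ^ 4 ≤ 0) : c₁ = 0 ∧ c₂ ≤ 0 := by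
  have small : ∀ {d₀ d₁ d₂ d₃ : ℝ},
      (∀ s : ℝ, 0 < s → d₀ + d₁ * s + d₂ * s ^ 2 + d₃ * s ^ 3 ≤ 0) → d₀ ≤ 0 := by
    intro d₀ d₁ d₂ d₃ hd
    have ht : Filter.Tendsto (fun s : ℝ => d₀ + d₁ * s + d₂ * s ^ 2 + d₃ * s ^ 3)
        (nhdsWithin 0 (Set.Ioi 0)) (nhds d₀) := by
      have hc : Continuous fun s : ℝ => d₀ + d₁ * s + d₂ * s ^ 2 + d₃ * s ^ 3 := by fun_prop
      simpa using (hc.tendsto 0).mono_left nhdsWithin_le_nhds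
    exact le_of_tendsto ht (Filter.eventually_of_mem self_mem_nhdsWithin hd)
  have h1 : c₁ ≤ 0 := small (d₁ := c₂) (d₂ := c₃) (d₃ := c₄) fun s hs => by
    refine le_of_mul_le_mul_right ?_ hs
    linarith [h s]
  have h2 : -c₁ ≤ 0 := small (d₁ := c₂) (d₂ := -c₃) (d₃ := c₄) fun s hs => by
    refine le_of_mul_le_mul_right ?_ hs
    linarith [h (-s)]
  have h0 : c₁ = 0 := by linarith
  refine ⟨h0, small (d₁ := c₃) (d₂ := c₄) (d₃ := 0) fun s hs => ?_⟩
  refine le_of_mul_le_mul_right ?_ (pow_pos hs 2)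
  have := h s
  rw [h0] at this
  linarith

theorem exists_norm_eq_one_re_mul_eq_zero (m : ℂ) : ∃ z : ℂ, ‖z‖ = 1 ∧ (z * m).re = 0 := by
  obtain ⟨z, hz, h⟩ := exists_norm_eq_one_mul_eq_conj_mul (α := m) (β := -(starRingEnd ℂ) m)
    (by simp)
  refine ⟨z, hz, ?_⟩
  have := congrArg Complex.re h
  simp at this ⊢
  linarith

theorem norm_map_add_real_smul_sq {E F : Type*} [NormedAddCommGroup E] [InnerProductSpace ℂ E]
    [NormedAddCommGroup F] [InnerProductSpace ℂ F] (f : E →L[ℂ] F) (x y : E) (s : ℝ) :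
    ‖f (x + (s : ℂ) • y)‖ ^ 2 =
      ‖f x‖ ^ 2 + 2 * s * (⟪f x, f y⟫_ℂ).re + s ^ 2 * ‖f y‖ ^ 2 := by
  rw [map_add, map_smul, @norm_add_sq ℂ, inner_smul_right, norm_smul]
  simp [mul_pow]
  ring

theorem norm_map_smul_add_sq {E F : Type*} [NormedAddCommGroup E] [InnerProductSpace ℂ E]
    [NormedAddCommGroup F] [InnerProductSpace ℂ F] (f : E →L[ℂ] F) (x y : E) (c : ℂ) :
    ‖f (c • x + y)‖ ^ 2 =
      ‖c‖ ^ 2 * ‖f x‖ ^ 2 + 2 * ((starRingEnd ℂ) c * ⟪f x, f y⟫_ℂ).re + ‖f y‖ ^ 2 := by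
  rw [map_add, map_smul, @norm_add_sq ℂ, inner_smul_left, norm_smul, mul_pow]
  rfl

/-- If `η₀` maximizes `‖a η‖ ‖b η‖` on the unit sphere, then the joint numerical range of
`a* a` and `b* b` lies below the tangent at the corresponding point. -/
theorem tangent_of_isMax_norm_mul_norm {E F : Type*} [NormedAddCommGroup E]
    [InnerProductSpace ℂ E] [NormedAddCommGroup F] [InnerProductSpace ℂ F] {a b : E →L[ℂ] F}
    {η₀ : E} (hη₀ : ‖η₀‖ = 1)
    (hmax : ∀ η, ‖a η‖ ^ 2 * ‖b η‖ ^ 2 ≤ ‖a η₀‖ ^ 2 * ‖b η₀‖ ^ 2 * (‖η‖ ^ 2) ^ 2) (η : E) :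
    ‖b η₀‖ ^ 2 * ‖a η‖ ^ 2 + ‖a η₀‖ ^ 2 * ‖b η‖ ^ 2 ≤
      2 * (‖a η₀‖ ^ 2 * ‖b η₀‖ ^ 2) * ‖η‖ ^ 2 := by
  set A := ‖a η₀‖ ^ 2 with hA
  set B := ‖b η₀‖ ^ 2 with hB
  have orth : ∀ ζ, ⟪η₀, ζ⟫_ℂ = 0 →
      B * (⟪a η₀, a ζ⟫_ℂ).re + A * (⟪b η₀, b ζ⟫_ℂ).re = 0 ∧
      B * ‖a ζ‖ ^ 2 + A * ‖b ζ‖ ^ 2 + 4 * (⟪a η₀, a ζ⟫_ℂ).re * (⟪b η₀, b ζ⟫_ℂ).re ≤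
        2 * (A * B) * ‖ζ‖ ^ 2 := by
    intro ζ hζ
    set P := (⟪a η₀, a ζ⟫_ℂ).re
    set Q := (⟪b η₀, b ζ⟫_ℂ).re
    -- These are the coefficients in `s` of `hmax` at `η₀ + s • ζ`; the constant terms cancel.
    obtain ⟨h1, h2⟩ := coeff_of_quartic_nonpos (c₁ := 2 * (B * P + A * Q))
      (c₂ := B * ‖a ζ‖ ^ 2 + A * ‖b ζ‖ ^ 2 + 4 * P * Q - 2 * (A * B) * ‖ζ‖ ^ 2)
      (c₃ := 2 * P * ‖b ζ‖ ^ 2 + 2 * Q * ‖a ζ‖ ^ 2)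
      (c₄ := ‖a ζ‖ ^ 2 * ‖b ζ‖ ^ 2 - A * B * (‖ζ‖ ^ 2) ^ 2) fun s => by
        have h := hmax (η₀ + (s : ℂ) • ζ)
        have hid := norm_map_add_real_smul_sq (ContinuousLinearMap.id ℂ E) η₀ ζ s
        simp only [ContinuousLinearMap.id_apply, hζ, hη₀, Complex.zero_re] at hid
        rw [norm_map_add_real_smul_sq, norm_map_add_real_smul_sq, hid] at h
        linarith
    exact ⟨by linarith, by linarith⟩
  have cross : ∀ ζ, ⟪η₀, ζ⟫_ℂ = 0 → (B : ℂ) * ⟪a η₀, a ζ⟫_ℂ + A * ⟪b η₀, b ζ⟫_ℂ = 0 := by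
    intro ζ hζ
    have h1 := (orth ζ hζ).1
    -- Rotating `ζ` by `I` turns the real-part identity into the imaginary one.
    have h2 := (orth (Complex.I • ζ) (by simp [hζ])).1
    simp at h2
    apply Complex.ext
    · simpa using h1
    · simp
      linarith
  have second : ∀ ζ, ⟪η₀, ζ⟫_ℂ = 0 →
      B * ‖a ζ‖ ^ 2 + A * ‖b ζ‖ ^ 2 ≤ 2 * (A * B) * ‖ζ‖ ^ 2 := by
    intro ζ hζ
    -- This phase kills the term `4 * P * Q` and leaves the norms unchanged.
    obtain ⟨z, hz, hre⟩ := exists_norm_eq_one_re_mul_eq_zero ⟪a η₀, a ζ⟫_ℂ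
    have h := (orth (z • ζ) (by simp [hζ])).2
    simpa only [map_smul, inner_smul_right, hre, norm_smul, hz, one_mul, mul_zero, zero_mul,
      add_zero] using h
  obtain ⟨c, hc⟩ : ∃ c : ℂ, c = ⟪η₀, η⟫_ℂ := ⟨_, rfl⟩
  obtain ⟨ζ, hζdef⟩ : ∃ ζ, ζ = η - c • η₀ := ⟨_, rfl⟩
  have hζ : ⟪η₀, ζ⟫_ℂ = 0 := by
    rw [hζdef, inner_sub_right, inner_smul_right, inner_self_eq_norm_sq_to_K, hη₀]
    simp [hc]
  have hη : η = c • η₀ + ζ := by rw [hζdef]; abel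
  have hid := norm_map_smul_add_sq (ContinuousLinearMap.id ℂ E) η₀ ζ c
  simp only [ContinuousLinearMap.id_apply, hζ, hη₀, mul_zero, Complex.zero_re] at hid
  have hcross : B * ((starRingEnd ℂ) c * ⟪a η₀, a ζ⟫_ℂ).re
      + A * ((starRingEnd ℂ) c * ⟪b η₀, b ζ⟫_ℂ).re = 0 := by
    rw [← Complex.re_ofReal_mul, ← Complex.re_ofReal_mul, ← Complex.add_re]
    have : (B : ℂ) * ((starRingEnd ℂ) c * ⟪a η₀, a ζ⟫_ℂ)
        + A * ((starRingEnd ℂ) c * ⟪b η₀, b ζ⟫_ℂ) = 0 := by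
      linear_combination (starRingEnd ℂ) c * cross ζ hζ
    rw [this, Complex.zero_re]
  rw [hη, norm_map_smul_add_sq, norm_map_smul_add_sq, hid, ← hA, ← hB]
  linarith [second ζ hζ]

theorem exists_norm_eq_one_norm_mul_norm_le [FiniteDimensional ℂ H] [Nontrivial H]
    (a b : H →L[ℂ] H) : ∃ η₀ : H, ‖η₀‖ = 1 ∧
      ∀ η, ‖a η‖ * ‖b η‖ ≤ ‖a η₀‖ * ‖b η₀‖ * ‖η‖ ^ 2 := by
  have : ProperSpace H := FiniteDimensional.proper ℂ H
  have hne : (Metric.sphere (0 : H) 1).Nonempty := by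
    obtain ⟨w, hw⟩ := exists_ne (0 : H)
    exact ⟨(‖w‖ : ℂ)⁻¹ • w, by simp [norm_smul, hw]⟩
  obtain ⟨η₀, hη₀, hmax⟩ := (isCompact_sphere (0 : H) 1).exists_isMaxOn hne
    (f := fun η => ‖a η‖ * ‖b η‖) (by fun_prop)
  refine ⟨η₀, by simpa using hη₀, fun η => ?_⟩
  by_cases hη : η = 0
  · simp [hη]
  have hn : 0 < ‖η‖ := norm_pos_iff.2 hη
  have h := hmax (a := (‖η‖ : ℂ)⁻¹ • η) (by simp [norm_smul, hη])
  simp only [Set.mem_ofPred_eq, map_smul, norm_smul, norm_inv, Complex.norm_real,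
    Real.norm_of_nonneg hn.le] at h
  calc ‖a η‖ * ‖b η‖ = ‖η‖⁻¹ * ‖a η‖ * (‖η‖⁻¹ * ‖b η‖) * ‖η‖ ^ 2 := by field_simp
    _ ≤ _ := by gcongr

theorem eq_zero_or_eq_zero_of_norm_mul_norm {a b : H →L[ℂ] H}
    (h : ∀ η, ‖a η‖ * ‖b η‖ = 0) : a = 0 ∨ b = 0 := by
  by_contra! hab
  obtain ⟨⟨x, hx⟩, y, hy⟩ : (∃ x, a x ≠ 0) ∧ ∃ y, b y ≠ 0 := by
    constructor
    · by_contra! h0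
      exact hab.1 (ContinuousLinearMap.ext h0)
    · by_contra! h0
      exact hab.2 (ContinuousLinearMap.ext h0)
  have hbx : b x = 0 := by simpa [hx] using h x
  have hay : a y = 0 := by simpa [hy] using h y
  -- At `x + y` the product is `‖a x‖ * ‖b y‖`, which is nonzero.
  simpa [hbx, hay, hx, hy] using h (x + y)

end

/-! ### Upper bound for the amplifications -/

section

variable {H : Type*} [NormedAddCommGroup H] [InnerProductSpace ℂ H]

theorem sum_mul_norm_map_sq_le {n : ℕ} {a b : H →L[ℂ] H} {s t N : ℝ}
    (h : ∀ η, s * ‖a η‖ ^ 2 + t * ‖b η‖ ^ 2 ≤ N * ‖η‖ ^ 2) (ξ : PiLp 2 (fun _ : Fin n => H)) :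
    s * ∑ i, ‖a (ξ i)‖ ^ 2 + t * ∑ i, ‖b (ξ i)‖ ^ 2 ≤ N * ‖ξ‖ ^ 2 := by
  rw [PiLp.norm_sq_eq_of_L2, Finset.mul_sum, Finset.mul_sum, Finset.mul_sum,
    ← Finset.sum_add_distrib]
  exact Finset.sum_le_sum fun i _ => h (ξ i)

theorem norm_sum_inner_le_of_norm_blockOperator_le_one {n : ℕ}
    {A : Matrix (Fin n) (Fin n) (H →L[ℂ] H)} (hA : ‖blockOperator A‖ ≤ 1)
    (ζ ξ : Fin n → H) :
    ‖∑ i, ∑ j, ⟪ζ i, A i j (ξ j)⟫_ℂ‖ ≤ √(∑ i, ‖ζ i‖ ^ 2) * √(∑ j, ‖ξ j‖ ^ 2) := by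
  have hinner : ∑ i, ∑ j, ⟪ζ i, A i j (ξ j)⟫_ℂ =
      ⟪WithLp.toLp 2 ζ, blockOperator A (WithLp.toLp 2 ξ)⟫_ℂ := by
    simp [PiLp.inner_apply, blockOperator_apply, inner_sum]
  have hn : ∀ χ : Fin n → H, √(∑ i, ‖χ i‖ ^ 2) = ‖WithLp.toLp 2 χ‖ := fun χ => by
    rw [PiLp.norm_eq_of_L2]
  rw [hinner, hn, hn]
  refine (norm_inner_le_norm _ _).trans ?_
  gcongr
  exact ((blockOperator A).le_opNorm _).trans (mul_le_of_le_one_left (norm_nonneg _) hA)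

/-- Cauchy–Schwarz for `(√(s p), √(t q))` and `(√(t q'), √(s p'))`; the weights cancel because `s *
t = 1`. -/
theorem sqrt_mul_sqrt_add_sqrt_mul_sqrt_le {s t N p q p' q' x y : ℝ} (hs : 0 < s)
    (hst : s * t = 1) (hN : 0 ≤ N) (hp : 0 ≤ p) (hq : 0 ≤ q) (hp' : 0 ≤ p') (hq' : 0 ≤ q')
    (hx : 0 ≤ x) (hy : 0 ≤ y) (h : s * p + t * q ≤ N * x ^ 2) (h' : s * p' + t * q' ≤ N * y ^ 2) :
    √p * √q' + √q * √p' ≤ N * x * y := by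
  have ht : 0 < t := by
    by_contra! ht
    nlinarith
  refine le_of_sq_le_sq ?_ (by positivity)
  have hp2 := Real.sq_sqrt hp
  have hq2 := Real.sq_sqrt hq
  have hp2' := Real.sq_sqrt hp'
  have hq2' := Real.sq_sqrt hq'
  set P := √p
  set Q := √q
  set P' := √p'
  set Q' := √q'
  calc (P * Q' + Q * P') ^ 2 ≤ (s * p + t * q) * (s * p' + t * q') := by
        rw [← hp2, ← hq2, ← hp2', ← hq2']
        have : (s * P ^ 2 + t * Q ^ 2) * (s * P' ^ 2 + t * Q' ^ 2) - (P * Q' + Q * P') ^ 2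
            = (s * (P * P') - t * (Q * Q')) ^ 2 := by
          linear_combination ((P * Q') ^ 2 + (Q * P') ^ 2 + 2 * P * P' * Q * Q') * hst
        nlinarith [sq_nonneg (s * (P * P') - t * (Q * Q'))]
    _ ≤ (N * x ^ 2) * (N * y ^ 2) := by gcongr
    _ = (N * x * y) ^ 2 := by ring

/-- Moving the left factors across the inner product as adjoints leaves two forms in the contraction
`A`. The weighted bounds hold on `Hⁿ` by summing over coordinates, so the estimate does not depend
on `n`. -/
theorem norm_blockOperator_map_jordanElementary_le [CompleteSpace H] {n : ℕ} {a b : H →L[ℂ] H}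
    {s t N : ℝ} (hs : 0 < s) (hst : s * t = 1) (hN : 0 ≤ N)
    (h : ∀ η, s * ‖a η‖ ^ 2 + t * ‖b η‖ ^ 2 ≤ N * ‖η‖ ^ 2)
    (h' : ∀ η, s * ‖a.adjoint η‖ ^ 2 + t * ‖b.adjoint η‖ ^ 2 ≤ N * ‖η‖ ^ 2)
    {A : Matrix (Fin n) (Fin n) (H →L[ℂ] H)} (hA : ‖blockOperator A‖ ≤ 1) :
    ‖blockOperator (A.map (jordanElementary a b))‖ ≤ N := by
  refine ContinuousLinearMap.opNorm_le_bound _ hN fun ξ => ?_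
  have key : ∀ ζ : PiLp 2 (fun _ : Fin n => H),
      ‖⟪ζ, blockOperator (A.map (jordanElementary a b)) ξ⟫_ℂ‖ ≤ N * ‖ζ‖ * ‖ξ‖ := by
    intro ζ
    have hsplit : ⟪ζ, blockOperator (A.map (jordanElementary a b)) ξ⟫_ℂ =
        ∑ i, ∑ j, ⟪a.adjoint (ζ i), A i j (b (ξ j))⟫_ℂ +
          ∑ i, ∑ j, ⟪b.adjoint (ζ i), A i j (a (ξ j))⟫_ℂ := by
      simp [PiLp.inner_apply, blockOperator_apply, inner_sum, jordanElementary_apply,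
        inner_add_right, Finset.sum_add_distrib, ContinuousLinearMap.adjoint_inner_left]
    rw [hsplit]
    refine (norm_add_le _ _).trans ?_
    refine (add_le_add (norm_sum_inner_le_of_norm_blockOperator_le_one hA _ _)
      (norm_sum_inner_le_of_norm_blockOperator_le_one hA _ _)).trans ?_
    exact sqrt_mul_sqrt_add_sqrt_mul_sqrt_le hs hst hN (by positivity) (by positivity)
      (by positivity) (by positivity) (norm_nonneg _) (norm_nonneg _)
      (sum_mul_norm_map_sq_le h' ζ) (sum_mul_norm_map_sq_le h ξ)
  set χ := blockOperator (A.map (jordanElementary a b)) ξ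
  by_cases hχ : ‖χ‖ = 0
  · rw [hχ]
    positivity
  · have hpos : 0 < ‖χ‖ := lt_of_le_of_ne (norm_nonneg _) (Ne.symm hχ)
    have := key χ
    rw [inner_self_eq_norm_sq_to_K, norm_pow, RCLike.norm_ofReal, abs_norm, sq] at this
    refine le_of_mul_le_mul_right ?_ hpos
    linarith

theorem IsConjugation.norm_adjoint_apply [CompleteSpace H] {J : H →ₛₗ[starRingEnd ℂ] H}
    (hJ : IsConjugation J) {a : H →L[ℂ] H} (ha : ∀ x y, ⟪J (a x), y⟫_ℂ = ⟪J x, a y⟫_ℂ) (η : H) :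
    ‖a.adjoint η‖ = ‖a (J η)‖ := by
  have : a.adjoint η = J (a (J η)) := by
    refine ext_inner_right ℂ fun y => ?_
    rw [ContinuousLinearMap.adjoint_inner_left, ha, hJ.involutive]
  rw [this, hJ.norm_map]

theorem norm_blockOperator_one (x : H →L[ℂ] H) :
    ‖blockOperator (Matrix.of fun _ _ : Fin 1 => x)‖ = ‖x‖ := by
  have hn : ∀ ξ : PiLp 2 (fun _ : Fin 1 => H), ‖ξ‖ = ‖ξ 0‖ := fun ξ => by
    simp [PiLp.norm_eq_of_L2]
  refine le_antisymm ?_ ?_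
  · refine ContinuousLinearMap.opNorm_le_bound _ (norm_nonneg _) fun ξ => ?_
    rw [hn, hn, blockOperator_apply, Fin.sum_univ_one, Matrix.of_apply]
    exact x.le_opNorm _
  · refine ContinuousLinearMap.opNorm_le_bound _ (ContinuousLinearMap.opNorm_nonneg _) fun y => ?_
    have := (blockOperator (Matrix.of fun _ _ : Fin 1 => x)).le_opNorm (WithLp.toLp 2 fun _ => y)
    rwa [hn, hn, blockOperator_apply, Fin.sum_univ_one, Matrix.of_apply] at this

theorem enorm_le_cbNorm (T : (H →L[ℂ] H) →L[ℂ] (H →L[ℂ] H)) : ‖T‖ₑ ≤ cbNorm T := by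
  by_cases htop : cbNorm T = ⊤
  · simp [htop]
  have hle : ∀ x : H →L[ℂ] H, ‖x‖ ≤ 1 → ‖T x‖ ≤ (cbNorm T).toReal := by
    intro x hx
    have h : ‖blockOperator ((Matrix.of fun _ _ : Fin 1 => x).map T)‖ₑ ≤ cbNorm T :=
      le_iSup_of_le 1 <| le_iSup_of_le (Matrix.of fun _ _ => x) <|
        le_iSup_of_le ((norm_blockOperator_one x).trans_le hx) le_rfl
    have h2 := ENNReal.toReal_mono htop h
    rw [toReal_enorm] at h2
    exact (norm_blockOperator_one (T x)).symm.trans_le h2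
  have hT : ‖T‖ ≤ (cbNorm T).toReal :=
    T.opNorm_le_of_unit_norm ENNReal.toReal_nonneg fun x hx => hle x hx.le
  rw [← ofReal_norm]
  exact ENNReal.ofReal_le_of_le_toReal hT

theorem cbNorm_le_ofReal {T : (H →L[ℂ] H) →L[ℂ] (H →L[ℂ] H)} {N : ℝ}
    (h : ∀ (n : ℕ) (A : Matrix (Fin n) (Fin n) (H →L[ℂ] H)), ‖blockOperator A‖ ≤ 1 →
      ‖blockOperator (A.map T)‖ ≤ N) : cbNorm T ≤ ENNReal.ofReal N := by
  refine iSup_le fun n => iSup_le fun A => iSup_le fun hA => ?_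
  rw [← ofReal_norm]
  exact ENNReal.ofReal_le_ofReal (h n A hA)

theorem cbNorm_zero : cbNorm (0 : (H →L[ℂ] H) →L[ℂ] (H →L[ℂ] H)) = 0 := by
  refine le_antisymm ?_ bot_le
  simpa using cbNorm_le_ofReal (T := (0 : (H →L[ℂ] H) →L[ℂ] (H →L[ℂ] H))) (N := 0)
    fun n A _ => ContinuousLinearMap.opNorm_le_bound _ le_rfl fun ξ => by
      rw [PiLp.norm_eq_of_L2]
      simp [blockOperator_apply]

theorem exists_pos_mul_norm_sq_add_le {a b : H →L[ℂ] H} {η₀ : H} (hη₀ : ‖η₀‖ = 1)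
    (hmax : ∀ η, ‖a η‖ * ‖b η‖ ≤ ‖a η₀‖ * ‖b η₀‖ * ‖η‖ ^ 2) (h0 : ‖a η₀‖ * ‖b η₀‖ ≠ 0) :
    ∃ s t : ℝ, 0 < s ∧ s * t = 1 ∧
      ∀ η, s * ‖a η‖ ^ 2 + t * ‖b η‖ ^ 2 ≤ 2 * (‖a η₀‖ * ‖b η₀‖) * ‖η‖ ^ 2 := by
  have ha : 0 < ‖a η₀‖ := (norm_nonneg _).lt_of_ne' (left_ne_zero_of_mul h0)
  have hb : 0 < ‖b η₀‖ := (norm_nonneg _).lt_of_ne' (right_ne_zero_of_mul h0)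
  -- The tangent inequality divided by `‖a η₀‖ * ‖b η₀‖`, which makes the weights reciprocal.
  refine ⟨‖b η₀‖ / ‖a η₀‖, ‖a η₀‖ / ‖b η₀‖, by positivity, by field_simp, fun η => ?_⟩
  have h := tangent_of_isMax_norm_mul_norm hη₀ (fun η => by
    rw [← mul_pow, ← mul_pow, ← mul_pow]
    exact pow_le_pow_left₀ (by positivity) (hmax η) 2) η
  refine le_of_mul_le_mul_left ?_ (mul_pos ha hb)
  calc _ = ‖b η₀‖ ^ 2 * ‖a η‖ ^ 2 + ‖a η₀‖ ^ 2 * ‖b η‖ ^ 2 := by field_simp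
    _ ≤ _ := h
    _ = _ := by ring

end

theorem proposition4p1 {H : Type*} [NormedAddCommGroup H] [InnerProductSpace ℂ H]
    (hH : Module.finrank ℂ H = 2) (a b : H →L[ℂ] H) (hab : a * b = b * a) :
    cbNorm (jordanElementary a b) = ‖jordanElementary a b‖ₑ := by
  have : FiniteDimensional ℂ H := Module.finite_of_finrank_pos (by omega)
  have : Nontrivial H := Module.nontrivial_of_finrank_pos (R := ℂ) (by omega)
  have : CompleteSpace H := FiniteDimensional.complete ℂ H
  refine le_antisymm ?_ (enorm_le_cbNorm _)
  obtain ⟨η₀, hη₀, hmax⟩ := exists_norm_eq_one_norm_mul_norm_le a b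
  by_cases h0 : ‖a η₀‖ * ‖b η₀‖ = 0
  · have hT : jordanElementary a b = 0 := by
      have hzero : ∀ η, ‖a η‖ * ‖b η‖ = 0 := fun η =>
        le_antisymm (by simpa only [h0, zero_mul] using hmax η) (by positivity)
      ext1 x
      rw [jordanElementary_apply]
      rcases eq_zero_or_eq_zero_of_norm_mul_norm hzero with rfl | rfl <;> simp
    rw [hT, cbNorm_zero]
    exact bot_le
  · obtain ⟨J, hJ, ha, hb⟩ := exists_isConjugation_symmetric_of_commute hH hab
    obtain ⟨s, t, hs, hst, h⟩ := exists_pos_mul_norm_sq_add_le hη₀ hmax h0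
    have h' : ∀ η, s * ‖a.adjoint η‖ ^ 2 + t * ‖b.adjoint η‖ ^ 2 ≤
        2 * (‖a η₀‖ * ‖b η₀‖) * ‖η‖ ^ 2 := fun η => by
      rw [hJ.norm_adjoint_apply ha, hJ.norm_adjoint_apply hb, ← hJ.norm_map η]
      exact h (J η)
    refine (cbNorm_le_ofReal fun n A hA =>
      norm_blockOperator_map_jordanElementary_le hs hst (by positivity) h h' hA).trans ?_
    rw [← ofReal_norm]
    exact ENNReal.ofReal_le_ofReal
      (two_mul_norm_mul_norm_le_norm_jordanElementary hH hJ ha hb hη₀)
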